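/- Let $K$ be a field that is complete with respect to a non-trivial discrete valuation, with perfect residue field of characteristic $p>0$. Let $L/K$ be a finite Galois extension whose Galois group $G=\mathrm{Gal}(L/K)$ is a $p$-group; $L$ is complete with respect to the unique discrete valuation extending that of $K$. Let $\mathcal{O}_K$ and $\mathcal{O}_L$ be the valuation rings, $\mathfrak{P}_L$ the maximal ideal of $\mathcal{O}_L$, and $v_L : L^{\times}\to\mathbb{Z}$ the normalised valuation of $L$. Put $\mathfrak{P}_L^{n}=\{0\}\cup\{x\in L^{\times} : v_L(x)\ge n\}$ for $n\in\mathbb{Z}$; these fractional ideals are modules over the group ring $\mathcal{O}_K[G]$. Assume that $L/K$ is totally ramified (its ramification index is $[L:K]$) and weakly ramified, i.e. the second ramification group $G_2=\{\sigma\in G : (\sigma-1)(\mathcal{O}_L)\subseteq\mathfrak{P}_L^{3}\}$ is trivial. Let $n\in\mathbb{Z}$. Then: (i) $G$ is an elementary abelian $p$-group. (ii) $\mathfrak{P}_L^{n}$ is a free $\mathcal{O}_K[G]$-module (necessarily of rank $1$) if and only if $n\equiv 1 \bmod |G|$. (iii) Suppose $n\equiv 1\bmod |G|$. Then $\delta\in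 L$ is a free generator of $\mathfrak{P}_L^{n}$ over $\mathcal{O}_K[G]$ (that is, $a\mapsto a\cdot\delta$ is a bijection from $\mathcal{O}_K[G]$ onto $\mathfrak{P}_L^{n}$) if and only if $\delta\neq 0$ and $v_L(\delta)=n$. -/

import Mathlib

open scoped WithZero Valued MonoidAlgebra

/-- `K` is a complete local field: it is complete with respect to a non-trivial discrete valuation.
The valuation `Valued.v` is multiplicative with values in `ℤᵐ⁰`, and it is normalised (surjective);
the usual additive valuation `v_K` is given by `Valued.v x = exp (-v_K x)` for `x ≠ 0`. -/
class IsCompleteLocalField (K : Type*) [Field K] [Valued K ℤᵐ⁰] : Prop where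
  complete : CompleteSpace K
  surjective_v : Function.Surjective (Valued.v : Valuation K ℤᵐ⁰)

/-- `G` is an elementary abelian `p`-group: it is abelian and killed by `p`. -/
def IsElementaryAbelian (p : ℕ) (G : Type*) [Group G] : Prop :=
  (∀ a b : G, a * b = b * a) ∧ ∀ a : G, a ^ p = 1

namespace LocalExt

section GaloisAction

variable {K L : Type*} [Field K] [Valued K ℤᵐ⁰] [Field L] [Algebra K L]

/-- The natural left action of the group ring `𝒪_K[Gal(L/K)]` on `L`. -/
noncomputable instance groupRingModule : Module 𝒪[K][Gal(L/K)] L :=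
  Module.compHom L
    (Representation.ofDistribMulAction 𝒪[K] Gal(L/K) L).asAlgebraHom.toRingHom

theorem single_smul (σ : Gal(L/K)) (a : 𝒪[K]) (x : L) :
    (MonoidAlgebra.single σ a : 𝒪[K][Gal(L/K)]) • x = (a : K) • σ x := by
  change (Representation.ofDistribMulAction 𝒪[K] Gal(L/K) L).asAlgebraHom
    (MonoidAlgebra.single σ a) x = _
  rw [Representation.asAlgebraHom_single]
  rfl

/-- `δ` is a free generator of the `𝒪_K[Gal(L/K)]`-submodule `M` of `L`: the map `a ↦ a • δ` is
injective on `𝒪_K[Gal(L/K)]` and its image is `M`. -/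
def IsFreeGenerator (M : Submodule 𝒪[K][Gal(L/K)] L) (δ : L) : Prop :=
  Function.Injective (fun a : 𝒪[K][Gal(L/K)] => a • δ) ∧
    Set.range (fun a : 𝒪[K][Gal(L/K)] => a • δ) = (M : Set L)

end GaloisAction

section Extension

variable {K L : Type*} [Field K] [Valued K ℤᵐ⁰] [IsCompleteLocalField K]
  [Field L] [Valued L ℤᵐ⁰] [Algebra K L]
  [(Valued.v : Valuation K ℤᵐ⁰).HasExtension (Valued.v : Valuation L ℤᵐ⁰)]

/-- Neighbourhoods of zero in a valued field. -/
theorem mem_nhds_zero' {F : Type*} [Field F] [Valued F ℤᵐ⁰] {s : Set F} :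
    s ∈ nhds (0 : F) ↔ ∃ y : F, y ≠ 0 ∧ {x : F | Valued.v x < Valued.v y} ⊆ s := by
  rw [Valued.mem_nhds_zero]
  constructor
  · rintro ⟨γ, hγ⟩
    obtain ⟨y, hy⟩ := MonoidWithZeroHom.ValueGroup₀.restrict₀_surjective _ γ.1
    have hy' : (Valued.v : Valuation F ℤᵐ⁰).restrict y = γ.1 := hy
    refine ⟨y, ?_, fun x hx => hγ ?_⟩
    · rintro rfl
      exact γ.ne_zero (by rw [← hy', map_zero])
    · change _ < γ.1
      rw [← hy', Valuation.restrict_lt_iff]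
      exact hx
  · rintro ⟨y, hy, h⟩
    have h0 : (Valued.v : Valuation F ℤᵐ⁰).restrict y ≠ 0 := by simpa using hy
    refine ⟨Units.mk0 _ h0, fun x hx => h ?_⟩
    exact (Valuation.restrict_lt_iff _).mp hx

theorem exists_ne_zero_v_lt_one (K : Type*) [Field K] [Valued K ℤᵐ⁰] [IsCompleteLocalField K] :
    ∃ x : K, x ≠ 0 ∧ Valued.v x < 1 := by
  obtain ⟨x, hx⟩ := IsCompleteLocalField.surjective_v (K := K) (WithZero.exp (-1))
  refine ⟨x, ?_, ?_⟩
  · rintro rfl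
    rw [map_zero] at hx
    exact WithZero.exp_ne_zero hx.symm
  · rw [hx, ← WithZero.exp_zero, WithZero.exp_lt_exp]
    norm_num

theorem continuous_algebraMap : Continuous (algebraMap K L) := by
  refine continuous_of_continuousAt_zero (algebraMap K L) ?_
  intro s hs
  rw [map_zero, mem_nhds_zero'] at hs
  obtain ⟨y, hy, hs⟩ := hs
  obtain ⟨x, hx0, hx⟩ := exists_ne_zero_v_lt_one K
  have hx' : (Valued.v (algebraMap K L x) : ℤᵐ⁰) < 1 :=
    (Valuation.HasExtension.val_map_lt_one_iff Valued.v Valued.v x).mpr hx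
  have hy' : (Valued.v y : ℤᵐ⁰) ≠ 0 := by simpa using hy
  obtain ⟨n, hn⟩ := exists_pow_lt₀ hx' (Units.mk0 _ hy')
  rw [Filter.mem_map, mem_nhds_zero']
  refine ⟨x ^ n, pow_ne_zero _ hx0, fun z hz => hs ?_⟩
  have hz' := (Valuation.HasExtension.val_map_lt_iff (Valued.v : Valuation K ℤᵐ⁰)
    (Valued.v : Valuation L ℤᵐ⁰) z (x ^ n)).mpr hz
  rw [map_pow, map_pow] at hz'
  exact hz'.trans hn

theorem continuous_galois [FiniteDimensional K L] (σ : Gal(L/K)) : Continuous σ := by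
  have hc : CompleteSpace K := IsCompleteLocalField.complete
  obtain ⟨x, hx0, hx⟩ := exists_ne_zero_v_lt_one K
  let _ : (Valued.v : Valuation K ℤᵐ⁰).RankOne :=
    { toRankLeOne :=
        { hom' := (WithZeroMulInt.toNNReal (e := 2) (by norm_num)).comp
            MonoidWithZeroHom.ValueGroup₀.embedding
          strictMono' := (WithZeroMulInt.toNNReal_strictMono (by norm_num)).comp
            MonoidWithZeroHom.ValueGroup₀.embedding_strictMono }
      exists_val_nontrivial := ⟨x, by simpa using hx0, hx.ne⟩ }
  let _ : NontriviallyNormedField K := Valued.toNontriviallyNormedField K ℤᵐ⁰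
  have _ : ContinuousSMul K L := by
    refine ⟨?_⟩
    simp only [Algebra.smul_def]
    exact (continuous_algebraMap.comp continuous_fst).mul continuous_snd
  exact LinearMap.continuous_of_finiteDimensional (𝕜 := K) σ.toLinearMap

theorem v_galois_lt_one [FiniteDimensional K L] (σ : Gal(L/K)) {x : L}
    (hx : (Valued.v x : ℤᵐ⁰) < 1) : (Valued.v (σ x) : ℤᵐ⁰) < 1 := by
  have h1 : {z : L | (Valued.v z : ℤᵐ⁰) < 1} ∈ nhds (σ 0) := by
    rw [map_zero, mem_nhds_zero']
    exact ⟨1, one_ne_zero, by simp⟩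
  have h2 := (continuous_galois σ).continuousAt h1
  rw [Filter.mem_map, mem_nhds_zero'] at h2
  obtain ⟨y, hy, h⟩ := h2
  have hy' : (Valued.v y : ℤᵐ⁰) ≠ 0 := by simpa using hy
  obtain ⟨n, hn⟩ := exists_pow_lt₀ hx (Units.mk0 _ hy')
  have h3 : (Valued.v (σ (x ^ n)) : ℤᵐ⁰) < 1 := h (by simpa using hn)
  by_contra hcon
  rw [map_pow, map_pow] at h3
  exact absurd h3 (not_lt.mpr (one_le_pow₀ (not_lt.mp hcon)))

theorem v_le_v_galois [FiniteDimensional K L] (σ : Gal(L/K)) (x : L) :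
    (Valued.v x : ℤᵐ⁰) ≤ Valued.v (σ x) := by
  by_contra hcon
  rw [not_le] at hcon
  have hx : x ≠ 0 := by
    rintro rfl
    simp at hcon
  have hx' : (Valued.v x : ℤᵐ⁰) ≠ 0 := by simpa using hx
  have hu : (Valued.v (σ x / x) : ℤᵐ⁰) < 1 := by
    rw [map_div₀]
    exact (div_lt_one₀ (zero_lt_iff.mpr hx')).mpr hcon
  have key : ∀ k : ℕ, (Valued.v ((σ ^ (k + 1)) x) : ℤᵐ⁰) < Valued.v x := by
    intro k
    induction k with
    | zero => simpa using hcon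
    | succ k ih =>
      refine lt_of_le_of_lt ?_ ih
      have h1 : (σ ^ (k + 1 + 1)) x = (σ ^ (k + 1)) (σ x / x) * (σ ^ (k + 1)) x := by
        rw [← map_mul, div_mul_cancel₀ _ hx, pow_succ σ (k + 1)]
        rfl
      rw [h1, map_mul]
      exact mul_le_of_le_one_left' (v_galois_lt_one _ hu).le
  obtain ⟨n, hn, hσ⟩ := (isOfFinOrder_of_finite σ).exists_pow_eq_one
  have := key (n - 1)
  rw [Nat.sub_add_cancel hn, hσ] at this
  exact lt_irrefl _ this

/-- Galois automorphisms preserve the valuation of `L`. -/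
theorem v_galois [FiniteDimensional K L] (σ : Gal(L/K)) (x : L) :
    (Valued.v (σ x) : ℤᵐ⁰) = Valued.v x := by
  refine le_antisymm ?_ (v_le_v_galois σ x)
  have := v_le_v_galois σ⁻¹ (σ x)
  rwa [show σ⁻¹ (σ x) = x from σ.symm_apply_apply x] at this

variable (K L) [FiniteDimensional K L]

/-- The fractional ideal `𝔓_L ^ n = {x ∈ L | v_L(x) ≥ n}`, for `n : ℤ`, as an
`𝒪_K[Gal(L/K)]`-submodule of `L`. -/
noncomputable def primePow (n : ℤ) : Submodule 𝒪[K][Gal(L/K)] L where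
  carrier := {x | Valued.v x ≤ WithZero.exp (-n)}
  add_mem' := by
    intro x y hx hy
    exact (Valuation.map_add Valued.v x y).trans (max_le hx hy)
  zero_mem' := by simp
  smul_mem' := by
    intro a x hx
    change (Valued.v (a • x) : ℤᵐ⁰) ≤ _
    induction a using MonoidAlgebra.induction_linear with
    | zero => simp
    | add f g hf hg =>
      rw [add_smul]
      exact (Valuation.map_add _ _ _).trans (max_le hf hg)
    | single σ a =>
      rw [single_smul, Algebra.smul_def, map_mul, v_galois]
      refine (mul_le_of_le_one_left' ?_).trans hx
      exact (Valuation.HasExtension.val_map_le_one_iff Valued.v Valued.v _).mpr a.2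

/-- The `i`-th ramification group in the lower numbering,
`G_i = {σ | (σ - 1)(𝒪_L) ⊆ 𝔓_L ^ (i + 1)}`. -/
noncomputable def ramificationGroup (i : ℤ) : Subgroup Gal(L/K) where
  carrier := {σ | ∀ x : 𝒪[L], σ (x : L) - x ∈ primePow K L (i + 1)}
  one_mem' := fun x => by simp
  mul_mem' := by
    intro σ τ hσ hτ x
    have hx : τ (x : L) ∈ 𝒪[L] := by
      rw [Valuation.mem_integer_iff, v_galois]
      exact x.2
    have h := add_mem (hσ ⟨τ x, hx⟩) (hτ x)
    simpa using h
  inv_mem' := by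
    intro σ hσ x
    have hx : σ⁻¹ (x : L) ∈ 𝒪[L] := by
      rw [Valuation.mem_integer_iff, v_galois]
      exact x.2
    have h := neg_mem (hσ ⟨σ⁻¹ x, hx⟩)
    have e : σ (σ⁻¹ (x : L)) = x := σ.apply_symm_apply x
    simpa [e] using h

/-- `L/K` is weakly ramified: its second ramification group is trivial. -/
def IsWeaklyRamified : Prop := ramificationGroup K L 2 = ⊥

/-- `L/K` is totally ramified: its ramification index equals its degree. -/
def IsTotallyRamified : Prop :=
  (IsLocalRing.maximalIdeal 𝒪[L]).ramificationIdx 𝒪[K] = Module.finrank K L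

end Extension

end LocalExt

set_option linter.unusedSectionVars false

namespace LocalExt

/-! ### Discrete valuation rings in multiplicative notation -/

section DiscreteValuation

variable {F : Type*} [Field F] [Valued F ℤᵐ⁰]

/-! Write N = [L:K] = |G| and let π be a uniformizer of L. Total ramification makes elements whose
valuations are distinct mod N orthogonal over K, so 1, π, …, π^(N-1) is an orthogonal basis.
Wildness and weak ramification give v_L(σπ - π) = 2 for all σ ≠ 1. Hence σ ↦ (σπ/π - 1)/π mod 𝔓_L
embeds G in the additive group of a field of characteristic p (`isElementaryAbelian_gal`).

The same equality gives f'(π) valuation 2(N-1), where f is the minimal polynomial of π. By Euler's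
formula Tr x is the last coordinate of x·f'(π) in the basis of powers of π. So v_L(Tr x) ≥ v_L(x) +
N - 1, with equality when v_L(x) ≡ 1 mod N (`exists_sum_galois_eq_algebraMap`).

For v_L(δ) = qN + 1, a group ring element nonzero modulo the maximal ideal has a multiple congruent
to a unit times ∑ σ, the socle of the residual group algebra. The exact trace valuation therefore
bounds v_L(a • δ) from above (`smul_notMem_primePow`), which forces freeness. Conversely, in a free
module every invariant is a trace, and the trace inequality then excludes every n not congruent to
1. -/

theorem exists_v_eq_exp {x : F} (hx : x ≠ 0) : ∃ m : ℤ, (Valued.v x : ℤᵐ⁰) = WithZero.exp m :=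
  ⟨WithZero.log (Valued.v x), (WithZero.exp_log ((Valuation.ne_zero_iff _).mpr hx)).symm⟩

theorem lt_exp_iff_le_exp {a : ℤᵐ⁰} {m : ℤ} :
    a < WithZero.exp m ↔ a ≤ WithZero.exp (m - 1) := by
  rcases eq_or_ne a 0 with rfl | ha
  · simp
  · rw [← WithZero.exp_log ha, WithZero.exp_lt_exp, WithZero.exp_le_exp]
    omega

theorem lt_one_iff_le_exp {a : ℤᵐ⁰} : a < 1 ↔ a ≤ WithZero.exp (-1) := by
  rw [← WithZero.exp_zero, lt_exp_iff_le_exp, zero_sub]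

theorem exists_uniformizer (F : Type*) [Field F] [Valued F ℤᵐ⁰] [IsCompleteLocalField F] :
    ∃ x : F, (Valued.v x : ℤᵐ⁰) = WithZero.exp (-1) :=
  IsCompleteLocalField.surjective_v _

theorem ne_zero_of_v_eq_exp {x : F} {m : ℤ} (hx : (Valued.v x : ℤᵐ⁰) = WithZero.exp m) :
    x ≠ 0 := by
  rintro rfl
  rw [map_zero] at hx
  exact WithZero.exp_ne_zero hx.symm

theorem irreducible_of_v_eq {x : 𝒪[F]} (hx : (Valued.v (x : F) : ℤᵐ⁰) = WithZero.exp (-1)) :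
    Irreducible x := by
  have hi : Valuation.Integers (Valued.v : Valuation F ℤᵐ⁰) 𝒪[F] := Valuation.integer.integers _
  refine ⟨fun h => ?_, fun a b hab => ?_⟩
  · have := hi.isUnit_iff_valuation_eq_one.mp h
    change (Valued.v (x : F) : ℤᵐ⁰) = 1 at this
    rw [hx, ← WithZero.exp_zero, WithZero.exp_inj] at this
    omega
  · by_contra! hcon
    have h1 : ∀ y : 𝒪[F], ¬ IsUnit y → (Valued.v (y : F) : ℤᵐ⁰) ≤ WithZero.exp (-1) := by
      intro y hy
      rw [← lt_one_iff_le_exp]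
      exact lt_of_le_of_ne y.2 fun h => hy (hi.isUnit_iff_valuation_eq_one.mpr h)
    have h2 := mul_le_mul' (h1 a hcon.1) (h1 b hcon.2)
    rw [← map_mul, ← WithZero.exp_add, ← Subring.coe_mul, ← hab, hx, WithZero.exp_le_exp] at h2
    omega

theorem associated_pow_uniformizer {x y : 𝒪[F]}
    (hx : (Valued.v (x : F) : ℤᵐ⁰) = WithZero.exp (-1)) {n : ℕ}
    (hy : (Valued.v (y : F) : ℤᵐ⁰) = WithZero.exp (-(n : ℤ))) : Associated (x ^ n) y := by
  have hi : Valuation.Integers (Valued.v : Valuation F ℤᵐ⁰) 𝒪[F] := Valuation.integer.integers _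
  have h : (Valued.v ((x ^ n : 𝒪[F]) : F) : ℤᵐ⁰) = Valued.v (y : F) := by
    rw [Subring.coe_pow, map_pow, hx, hy, ← WithZero.exp_nsmul]
    simp
  exact associated_of_dvd_dvd (hi.dvd_of_le h.ge) (hi.dvd_of_le h.le)

variable (F) [IsCompleteLocalField F]

theorem isDiscreteValuationRing_integer : IsDiscreteValuationRing 𝒪[F] := by
  obtain ⟨x, hx⟩ := exists_uniformizer F
  have hx1 : (Valued.v x : ℤᵐ⁰) ≤ 1 := (lt_one_iff_le_exp.mpr hx.le).le
  refine IsDiscreteValuationRing.ofHasUnitMulPowIrreducibleFactorization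
    ⟨⟨x, hx1⟩, irreducible_of_v_eq hx, fun {y} hy => ?_⟩
  obtain ⟨m, hm⟩ := exists_v_eq_exp (x := (y : F)) (by simpa using hy)
  have hm0 : m ≤ 0 := by
    have := y.2
    rwa [Valuation.mem_integer_iff, hm, ← WithZero.exp_zero, WithZero.exp_le_exp] at this
  refine ⟨m.natAbs, associated_pow_uniformizer hx ?_⟩
  rw [hm]
  congr 1
  omega

end DiscreteValuation

/-! ### Valuations in a totally ramified extension -/

section Extension

variable {K L : Type*} [Field K] [Valued K ℤᵐ⁰] [IsCompleteLocalField K]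
  [Field L] [Valued L ℤᵐ⁰] [IsCompleteLocalField L] [Algebra K L]
  [(Valued.v : Valuation K ℤᵐ⁰).HasExtension (Valued.v : Valuation L ℤᵐ⁰)]
  [FiniteDimensional K L]

/-- Bridges the ideal-theoretic ramification index and the valuations: the maximal ideal of 𝒪[K]
generates a power of that of 𝒪[L], whose exponent is both the index and the valuation of a
uniformizer of K. -/
theorem v_algebraMap_uniformizer (htot : IsTotallyRamified K L) {x : K}
    (hx : (Valued.v x : ℤᵐ⁰) = WithZero.exp (-1)) :
    (Valued.v (algebraMap K L x) : ℤᵐ⁰) = WithZero.exp (-(Module.finrank K L : ℤ)) := by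
  have := isDiscreteValuationRing_integer K
  have := isDiscreteValuationRing_integer L
  have hx1 : (Valued.v x : ℤᵐ⁰) < 1 := lt_one_iff_le_exp.mpr hx.le
  obtain ⟨y, hy⟩ := exists_uniformizer L
  have hy1 : (Valued.v y : ℤᵐ⁰) < 1 := lt_one_iff_le_exp.mpr hy.le
  obtain ⟨m, hm⟩ := exists_v_eq_exp (x := algebraMap K L x)
    (by simpa using ne_zero_of_v_eq_exp hx)
  have hm0 : m < 0 := by
    have := (Valuation.HasExtension.val_map_lt_one_iff (Valued.v : Valuation K ℤᵐ⁰)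
      (Valued.v : Valuation L ℤᵐ⁰) x).mpr hx1
    rwa [hm, ← WithZero.exp_zero, WithZero.exp_lt_exp] at this
  let X : 𝒪[K] := ⟨x, hx1.le⟩
  let Y : 𝒪[L] := ⟨y, hy1.le⟩
  have hX : IsLocalRing.maximalIdeal 𝒪[K] = Ideal.span {X} :=
    (irreducible_of_v_eq (x := X) hx).maximalIdeal_eq
  have hY : IsLocalRing.maximalIdeal 𝒪[L] = Ideal.span {Y} :=
    (irreducible_of_v_eq (x := Y) hy).maximalIdeal_eq
  have hXY : (IsLocalRing.maximalIdeal 𝒪[K]).map (algebraMap 𝒪[K] 𝒪[L]) =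
      IsLocalRing.maximalIdeal 𝒪[L] ^ m.natAbs := by
    rw [hX, hY, Ideal.map_span, Set.image_singleton, Ideal.span_singleton_pow, eq_comm,
      Ideal.span_singleton_eq_span_singleton]
    refine associated_pow_uniformizer hy ?_
    refine Eq.trans ?_ (hm.trans ?_)
    · rfl
    · congr 1
      omega
  have hlies : (IsLocalRing.maximalIdeal 𝒪[L]).LiesOver (IsLocalRing.maximalIdeal 𝒪[K]) :=
    ⟨(IsLocalRing.maximalIdeal_comap (algebraMap 𝒪[K] 𝒪[L])).symm⟩
  have hne : (IsLocalRing.maximalIdeal 𝒪[L]) ≠ ⊥ := IsDiscreteValuationRing.not_a_field _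
  have he := Ideal.ramificationIdx'_eq_ramificationIdx' (IsLocalRing.maximalIdeal 𝒪[K])
    (IsLocalRing.maximalIdeal 𝒪[L]) (by rw [hXY]; exact pow_ne_zero _ hne)
  rw [Ideal.ramificationIdx'_spec hXY.le (by
    rw [hXY]
    intro h
    exact absurd h (not_le_of_gt (Ideal.pow_succ_lt_pow hne _))), htot] at he
  rw [hm]
  congr 1
  omega

/-- `HasExtension` only says that the valuations are equivalent, so the scaling factor is read off
from powers of a uniformizer. -/
theorem v_algebraMap (htot : IsTotallyRamified K L) (x : K) :
    (Valued.v (algebraMap K L x) : ℤᵐ⁰) = Valued.v x ^ Module.finrank K L := by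
  have hN : Module.finrank K L ≠ 0 := Module.finrank_pos.ne'
  rcases eq_or_ne x 0 with rfl | hx
  · simp [hN]
  obtain ⟨y, hy⟩ := exists_uniformizer K
  have hy0 := ne_zero_of_v_eq_exp hy
  obtain ⟨m, hm⟩ := exists_v_eq_exp hx
  have h1 : (Valued.v x : ℤᵐ⁰) = Valued.v (y ^ (-m)) := by
    rw [map_zpow₀, hy, hm, ← WithZero.exp_zsmul]
    simp
  rw [(Valuation.HasExtension.val_map_eq_iff (Valued.v : Valuation K ℤᵐ⁰)
    (Valued.v : Valuation L ℤᵐ⁰) x (y ^ (-m))).mpr h1, h1, map_zpow₀, map_zpow₀, map_zpow₀,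
    v_algebraMap_uniformizer htot hy, hy, ← WithZero.exp_zsmul, ← WithZero.exp_zsmul,
    ← WithZero.exp_nsmul]
  congr 1
  simp [mul_comm]

/-- A family whose valuations are distinct modulo the ramification index is orthogonal. -/
theorem v_smul_le_v_sum (htot : IsTotallyRamified K L) {ι : Type*} [Fintype ι] [Nonempty ι]
    {y : ι → L}
    {m : ι → ℤ} (hy : ∀ i, (Valued.v (y i) : ℤᵐ⁰) = WithZero.exp (m i))
    (hm : ∀ i j, m i ≡ m j [ZMOD Module.finrank K L] → i = j) (c : ι → K) :
    ∃ i₀, (Valued.v (∑ i, c i • y i) : ℤᵐ⁰) = Valued.v (c i₀ • y i₀) ∧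
      ∀ i, (Valued.v (c i • y i) : ℤᵐ⁰) ≤ Valued.v (∑ j, c j • y j) := by
  classical
  obtain ⟨i₀, -, hi₀⟩ := Finset.exists_max_image Finset.univ
    (fun i => (Valued.v (c i • y i) : ℤᵐ⁰)) Finset.univ_nonempty
  suffices hs : (Valued.v (∑ i, c i • y i) : ℤᵐ⁰) = Valued.v (c i₀ • y i₀) from
    ⟨i₀, hs, fun i => hs ▸ hi₀ i (Finset.mem_univ i)⟩
  by_cases h0 : c i₀ = 0
  · have : ∀ i, c i • y i = 0 := by
      intro i
      have := hi₀ i (Finset.mem_univ i)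
      simpa [h0] using this
    simp [this]
  · refine Valuation.map_sum_eq_of_lt _ (Finset.mem_univ i₀) fun i hi => ?_
    have hne : i ≠ i₀ := by simpa using hi
    refine lt_of_le_of_ne (hi₀ i (Finset.mem_univ i)) fun heq => hne ?_
    have hci : c i ≠ 0 := by
      intro hci
      rw [hci, zero_smul, map_zero, eq_comm, map_eq_zero, smul_eq_zero] at heq
      exact heq.elim h0 (ne_zero_of_v_eq_exp (hy i₀))
    obtain ⟨a, ha⟩ := exists_v_eq_exp hci
    obtain ⟨b, hb⟩ := exists_v_eq_exp h0
    rw [Algebra.smul_def, Algebra.smul_def, map_mul, map_mul, v_algebraMap htot,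
      v_algebraMap htot, ha, hb, hy, hy, ← WithZero.exp_nsmul, ← WithZero.exp_nsmul,
      ← WithZero.exp_add, ← WithZero.exp_add, WithZero.exp_inj] at heq
    refine hm i i₀ (Int.modEq_iff_dvd.mpr ⟨a - b, ?_⟩)
    simp only [nsmul_eq_mul] at heq
    linear_combination -heq

/-- Orthogonality excludes linear relations, so a family of the right size is a basis. -/
theorem exists_eq_sum_smul (htot : IsTotallyRamified K L) {ι : Type*} [Fintype ι] [Nonempty ι]
    {y : ι → L}
    {m : ι → ℤ} (hy : ∀ i, (Valued.v (y i) : ℤᵐ⁰) = WithZero.exp (m i))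
    (hm : ∀ i j, m i ≡ m j [ZMOD Module.finrank K L] → i = j)
    (hcard : Fintype.card ι = Module.finrank K L) (x : L) :
    ∃ c : ι → K, x = ∑ i, c i • y i := by
  have hli : LinearIndependent K y := by
    rw [Fintype.linearIndependent_iff]
    intro c hc i
    obtain ⟨-, -, h⟩ := v_smul_le_v_sum htot hy hm c
    have := h i
    rw [hc, map_zero, le_zero_iff, map_eq_zero, smul_eq_zero] at this
    exact this.resolve_right (ne_zero_of_v_eq_exp (hy i))
  have hx : x ∈ Submodule.span K (Set.range y) := by
    rw [hli.span_eq_top_of_card_eq_finrank' hcard]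
    trivial
  obtain ⟨c, hc⟩ := (Submodule.mem_span_range_iff_exists_fun K).mp hx
  exact ⟨c, hc.symm⟩

end Extension

end LocalExt

/-! ### Wild and weak ramification; the group is elementary abelian -/

namespace LocalExt

theorem residue_eq_zero_iff_v_lt_one {F : Type*} [Field F] [Valued F ℤᵐ⁰] (x : 𝒪[F]) :
    IsLocalRing.residue 𝒪[F] x = 0 ↔ (Valued.v (x : F) : ℤᵐ⁰) < 1 := by
  have hi : Valuation.Integers (Valued.v : Valuation F ℤᵐ⁰) 𝒪[F] := Valuation.integer.integers _
  rw [IsLocalRing.residue_eq_zero_iff, IsLocalRing.mem_maximalIdeal, mem_nonunits_iff,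
    hi.isUnit_iff_valuation_eq_one]
  exact ⟨fun h => lt_of_le_of_ne x.2 h, fun h => h.ne⟩

section Extension

variable {K L : Type*} [Field K] [Valued K ℤᵐ⁰] [IsCompleteLocalField K]
  [Field L] [Valued L ℤᵐ⁰] [IsCompleteLocalField L] [Algebra K L]
  [(Valued.v : Valuation K ℤᵐ⁰).HasExtension (Valued.v : Valuation L ℤᵐ⁰)]
  [FiniteDimensional K L]

theorem exists_v_smul_eq (htot : IsTotallyRamified K L) {c : K} (hc : c ≠ 0) {y : L} {m : ℤ}
    (hy : (Valued.v y : ℤᵐ⁰) = WithZero.exp m) :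
    ∃ a : ℤ, (Valued.v c : ℤᵐ⁰) = WithZero.exp a ∧
      (Valued.v (c • y) : ℤᵐ⁰) = WithZero.exp (Module.finrank K L * a + m) := by
  obtain ⟨a, ha⟩ := exists_v_eq_exp hc
  refine ⟨a, ha, ?_⟩
  rw [Algebra.smul_def, map_mul, v_algebraMap htot, ha, hy, ← WithZero.exp_nsmul,
    ← WithZero.exp_add, nsmul_eq_mul]

theorem v_pow_uniformizer {π : L} (hπ : (Valued.v π : ℤᵐ⁰) = WithZero.exp (-1)) (i : ℕ) :
    (Valued.v (π ^ i) : ℤᵐ⁰) = WithZero.exp (-(i : ℤ)) := by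
  rw [map_pow, hπ, ← WithZero.exp_nsmul]
  simp

theorem fin_eq_of_modEq {N : ℕ} {i j : Fin N} (h : (i : ℤ) ≡ j [ZMOD N]) : i = j := by
  have := Int.natCast_modEq_iff.mp h
  exact Fin.ext (Nat.ModEq.eq_of_lt_of_lt this i.2 j.2)

theorem fin_eq_of_neg_add_modEq {N : ℕ} (t : ℤ) (i j : Fin N)
    (h : -(i : ℤ) + t ≡ -(j : ℤ) + t [ZMOD N]) : i = j := by
  refine fin_eq_of_modEq ?_
  simpa using (Int.ModEq.add_right_cancel' t h).neg

theorem exists_eq_sum_pow_uniformizer (htot : IsTotallyRamified K L) {π : L}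
    (hπ : (Valued.v π : ℤᵐ⁰) = WithZero.exp (-1)) (x : L) :
    ∃ c : Fin (Module.finrank K L) → K, x = ∑ i, c i • π ^ (i : ℕ) ∧
      (∀ i, (Valued.v (c i • π ^ (i : ℕ)) : ℤᵐ⁰) ≤ Valued.v x) ∧
      ∃ i, (Valued.v x : ℤᵐ⁰) = Valued.v (c i • π ^ (i : ℕ)) := by
  have hne : Nonempty (Fin (Module.finrank K L)) := Fin.pos_iff_nonempty.mp Module.finrank_pos
  have hm : ∀ i j : Fin (Module.finrank K L), -(i : ℤ) ≡ -(j : ℤ) [ZMOD Module.finrank K L] →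
      i = j := fun i j h => fin_eq_of_neg_add_modEq 0 i j (by simpa using h)
  have hy := fun i : Fin (Module.finrank K L) => v_pow_uniformizer hπ (i : ℕ)
  obtain ⟨c, hc⟩ := exists_eq_sum_smul htot hy hm (by simp) x
  obtain ⟨i₀, h1, h2⟩ := v_smul_le_v_sum htot hy hm c
  rw [← hc] at h1 h2
  exact ⟨c, hc, h2, i₀, h1⟩

/-- The residue field extension is trivial. -/
theorem exists_v_sub_algebraMap_lt_one (htot : IsTotallyRamified K L) {x : L}
    (hx : (Valued.v x : ℤᵐ⁰) ≤ 1) : ∃ a : K, (Valued.v (x - algebraMap K L a) : ℤᵐ⁰) < 1 := by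
  obtain ⟨π, hπ⟩ := exists_uniformizer L
  obtain ⟨c, hc, hle, -⟩ := exists_eq_sum_pow_uniformizer htot hπ x
  let o : Fin (Module.finrank K L) := ⟨0, Module.finrank_pos⟩
  refine ⟨c o, ?_⟩
  have h1 : x - algebraMap K L (c o) = ∑ i ∈ Finset.univ.erase o, c i • π ^ (i : ℕ) := by
    rw [sub_eq_iff_eq_add, hc, ← Finset.sum_erase_add _ _ (Finset.mem_univ o)]
    simp [o, Algebra.smul_def]
  rw [h1]
  -- A nonzero term of index i has valuation congruent to i mod N, hence is not a unit when i ≠ 0.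
  refine Valuation.map_sum_lt _ one_ne_zero fun i hi => lt_of_le_of_ne ((hle i).trans hx) ?_
  rcases eq_or_ne (c i) 0 with h0 | h0
  · simp [h0]
  · obtain ⟨a, -, ha⟩ := exists_v_smul_eq htot h0 (v_pow_uniformizer hπ (i : ℕ))
    rw [ha, ← WithZero.exp_zero]
    intro h
    rw [WithZero.exp_inj] at h
    refine (Finset.mem_erase.mp hi).1 (fin_eq_of_modEq ?_)
    refine Int.modEq_iff_dvd.mpr ⟨-a, ?_⟩
    simp only [o]
    push_cast
    linear_combination h

theorem v_galois_sub_lt_one (htot : IsTotallyRamified K L) (σ : Gal(L/K)) {x : L}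
    (hx : (Valued.v x : ℤᵐ⁰) ≤ 1) : (Valued.v (σ x - x) : ℤᵐ⁰) < 1 := by
  obtain ⟨a, ha⟩ := exists_v_sub_algebraMap_lt_one htot hx
  have h : σ x - x = σ (x - algebraMap K L a) - (x - algebraMap K L a) := by
    simp
  rw [h]
  exact Valuation.map_sub_lt _ (by rwa [v_galois]) ha

theorem v_galois_div_self (σ : Gal(L/K)) {x : L} (hx : x ≠ 0) :
    (Valued.v (σ x / x) : ℤᵐ⁰) = 1 := by
  rw [map_div₀, v_galois, div_self ((Valuation.ne_zero_iff _).mpr hx)]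

/-- Since σ acts trivially on the residue field, the cocycle σ ↦ σx/x becomes multiplicative modulo
𝔓_L. -/
theorem v_pow_galois_div_sub_lt_one (htot : IsTotallyRamified K L) (σ : Gal(L/K)) {x : L}
    (hx : x ≠ 0) (j : ℕ) : (Valued.v ((σ ^ j) x / x - (σ x / x) ^ j) : ℤᵐ⁰) < 1 := by
  induction j with
  | zero => simp [hx]
  | succ j ih =>
    have hσ : σ x ≠ 0 := by simpa using hx
    have h : (σ ^ (j + 1)) x / x - (σ x / x) ^ (j + 1) =
        (σ ((σ ^ j) x / x) - (σ ^ j) x / x) * (σ x / x) +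
          ((σ ^ j) x / x - (σ x / x) ^ j) * (σ x / x) := by
      rw [pow_succ' σ, AlgEquiv.mul_apply, map_div₀]
      have h3 : σ ((σ ^ j) x) / σ x * (σ x / x) = σ ((σ ^ j) x) / x := by field_simp
      linear_combination -h3
    rw [h]
    refine Valuation.map_add_lt _ ?_ ?_
    · rw [map_mul, v_galois_div_self σ hx, mul_one]
      exact v_galois_sub_lt_one htot σ (v_galois_div_self _ hx).le
    · rwa [map_mul, v_galois_div_self σ hx, mul_one]

theorem charP_residueField (K L : Type*) [Field K] [Valued K ℤᵐ⁰] [Field L] [Valued L ℤᵐ⁰]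
    [Algebra K L] [(Valued.v : Valuation K ℤᵐ⁰).HasExtension (Valued.v : Valuation L ℤᵐ⁰)]
    (p : ℕ) [CharP 𝓀[K] p] : CharP 𝓀[L] p :=
  charP_of_injective_algebraMap (algebraMap 𝓀[K] 𝓀[L]).injective p

/-- A `p`-group acts by wild ramification. -/
theorem v_galois_div_self_sub_one_lt_one {p : ℕ} (hp : p.Prime) [CharP 𝓀[K] p]
    (hG : IsPGroup p Gal(L/K)) (htot : IsTotallyRamified K L) (σ : Gal(L/K)) {x : L}
    (hx : x ≠ 0) : (Valued.v (σ x / x - 1) : ℤᵐ⁰) < 1 := by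
  have := charP_residueField K L p
  have := Fact.mk hp
  obtain ⟨k, hk⟩ := hG σ
  have h := v_pow_galois_div_sub_lt_one htot σ hx (p ^ k)
  rw [hk, AlgEquiv.one_apply, div_self hx] at h
  let u : 𝒪[L] := ⟨σ x / x, (v_galois_div_self σ hx).le⟩
  have h1 : IsLocalRing.residue 𝒪[L] (1 - u ^ p ^ k) = 0 :=
    (residue_eq_zero_iff_v_lt_one _).mpr h
  have h2 : IsLocalRing.residue 𝒪[L] (u - 1) = 0 := by
    rw [map_sub, map_one] at h1 ⊢
    -- In characteristic p, (u - 1)^(p^k) = u^(p^k) - 1, so 1 is the only root of unity of p-power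
    -- order.
    refine eq_zero_of_pow_eq_zero (n := p ^ k) ?_
    rw [sub_pow_char_pow, one_pow, ← map_pow, ← neg_sub, h1, neg_zero]
  exact (residue_eq_zero_iff_v_lt_one _).mp h2

/-- Testing on π is enough because its powers span 𝒪[L] over 𝒪[K]. -/
theorem mem_ramificationGroup_two (htot : IsTotallyRamified K L) {π : L}
    (hπ : (Valued.v π : ℤᵐ⁰) = WithZero.exp (-1)) {σ : Gal(L/K)}
    (hσ : (Valued.v (σ π - π) : ℤᵐ⁰) ≤ WithZero.exp (-3)) : σ ∈ ramificationGroup K L 2 := by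
  intro x
  change (Valued.v (σ (x : L) - x) : ℤᵐ⁰) ≤ WithZero.exp (-(2 + 1))
  have hπ1 : (Valued.v π : ℤᵐ⁰) ≤ 1 := (lt_one_iff_le_exp.mpr hπ.le).le
  have hpow : ∀ i : ℕ, (Valued.v (σ (π ^ i) - π ^ i) : ℤᵐ⁰) ≤ WithZero.exp (-3) := by
    intro i
    induction i with
    | zero => simp
    | succ i ih =>
      have h : σ (π ^ (i + 1)) - π ^ (i + 1) =
          σ (π ^ i) * (σ π - π) + (σ (π ^ i) - π ^ i) * π := by
        simp only [map_pow]
        ring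
      rw [h]
      refine Valuation.map_add_le _ ?_ ?_
      · rw [map_mul, v_galois, map_pow]
        exact (mul_le_of_le_one_left' (pow_le_one' hπ1 i)).trans hσ
      · rw [map_mul]
        exact (mul_le_of_le_one_right' hπ1).trans ih
  obtain ⟨c, hc, hle, -⟩ := exists_eq_sum_pow_uniformizer htot hπ (x : L)
  have h : σ (x : L) - x = ∑ i, c i • (σ (π ^ (i : ℕ)) - π ^ (i : ℕ)) := by
    nth_rw 1 2 [hc]
    simp [smul_sub]
  rw [h]
  refine Valuation.map_sum_le _ fun i _ => ?_
  rcases eq_or_ne (c i) 0 with h0 | h0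
  · simp [h0]
  · obtain ⟨a, ha, ha'⟩ := exists_v_smul_eq htot h0 (v_pow_uniformizer hπ (i : ℕ))
    have h1 := (hle i).trans x.2
    rw [ha', ← WithZero.exp_zero, WithZero.exp_le_exp] at h1
    -- The coefficients are integral: N * a ≤ i < N.
    have ha0 : a ≤ 0 := by
      by_contra! hcon
      have h2 : (Module.finrank K L : ℤ) * 1 ≤ Module.finrank K L * a :=
        mul_le_mul_of_nonneg_left hcon (by positivity)
      have h3 := i.2
      omega
    rw [Algebra.smul_def, map_mul, v_algebraMap htot]
    refine (mul_le_of_le_one_left' (pow_le_one' ?_ _)).trans (hpow i)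
    rwa [ha, ← WithZero.exp_zero, WithZero.exp_le_exp]

/-- Wildness gives additive valuation at least 2; valuation at least 3 would put σ in the trivial
group G_2. -/
theorem v_galois_uniformizer_sub {p : ℕ} (hp : p.Prime) [CharP 𝓀[K] p]
    (hG : IsPGroup p Gal(L/K)) (htot : IsTotallyRamified K L) (hweak : IsWeaklyRamified K L)
    {π : L} (hπ : (Valued.v π : ℤᵐ⁰) = WithZero.exp (-1)) {σ : Gal(L/K)} (hσ : σ ≠ 1) :
    (Valued.v (σ π - π) : ℤᵐ⁰) = WithZero.exp (-2) := by
  have hπ0 := ne_zero_of_v_eq_exp hπ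
  refine le_antisymm ?_ ?_
  · rw [show σ π - π = π * (σ π / π - 1) by field_simp, map_mul, hπ]
    refine (mul_le_mul_right (lt_one_iff_le_exp.mp
      (v_galois_div_self_sub_one_lt_one hp hG htot σ hπ0)) _).trans ?_
    rw [← WithZero.exp_add]
    norm_num
  · by_contra! hcon
    rw [lt_exp_iff_le_exp] at hcon
    have := mem_ramificationGroup_two htot hπ (σ := σ) (by simpa using hcon)
    rw [hweak] at this
    exact hσ (by simpa using this)

theorem isElementaryAbelian_gal {p : ℕ} (hp : p.Prime) [CharP 𝓀[K] p]
    (hG : IsPGroup p Gal(L/K)) (htot : IsTotallyRamified K L) (hweak : IsWeaklyRamified K L) :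
    IsElementaryAbelian p Gal(L/K) := by
  have := charP_residueField K L p
  obtain ⟨π, hπ⟩ := exists_uniformizer L
  have hπ0 := ne_zero_of_v_eq_exp hπ
  have hσ0 : ∀ σ : Gal(L/K), σ π ≠ 0 := fun σ => by simpa using hπ0
  have hb : ∀ σ : Gal(L/K), (Valued.v ((σ π / π - 1) / π) : ℤᵐ⁰) ≤ 1 := by
    intro σ
    rw [map_div₀, hπ, div_le_one₀ WithZero.exp_pos, ← lt_one_iff_le_exp]
    exact v_galois_div_self_sub_one_lt_one hp hG htot σ hπ0
  let b : Gal(L/K) → 𝒪[L] := fun σ => ⟨(σ π / π - 1) / π, hb σ⟩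
  have hadd : ∀ σ τ : Gal(L/K), IsLocalRing.residue 𝒪[L] (b (σ * τ)) =
      IsLocalRing.residue 𝒪[L] (b σ) + IsLocalRing.residue 𝒪[L] (b τ) := by
    intro σ τ
    rw [← sub_eq_zero, ← map_add, ← map_sub, residue_eq_zero_iff_v_lt_one]
    -- With u = σπ/π, the exact cocycle relation is b(στ) = b(σ) + u² σ(b(τ)). Both σ - 1 on 𝒪[L]
    -- and u - 1 vanish modulo 𝔓_L.
    have h : ((b (σ * τ) - (b σ + b τ) : 𝒪[L]) : L) =
        (σ (b τ) - b τ) * (σ π / π) ^ 2 + (b τ * (σ π / π + 1)) * (σ π / π - 1) := by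
      change (σ (τ π) / π - 1) / π - ((σ π / π - 1) / π + (τ π / π - 1) / π) =
        (σ ((τ π / π - 1) / π) - (τ π / π - 1) / π) * (σ π / π) ^ 2 +
          ((τ π / π - 1) / π * (σ π / π + 1)) * (σ π / π - 1)
      have := hσ0 σ
      simp only [map_div₀, map_sub, map_one]
      field_simp
      ring
    rw [h]
    refine Valuation.map_add_lt _ ?_ ?_
    · rw [map_mul, map_pow, v_galois_div_self σ hπ0, one_pow, mul_one]
      exact v_galois_sub_lt_one htot σ (b τ).2
    · rw [map_mul, map_mul]
      refine lt_of_le_of_lt (mul_le_of_le_one_left' (mul_le_one' (b τ).2 ?_))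
        (v_galois_div_self_sub_one_lt_one hp hG htot σ hπ0)
      exact Valuation.map_add_le _ (v_galois_div_self σ hπ0).le (by simp)
  let θ : Gal(L/K) →* Multiplicative 𝓀[L] := MonoidHom.mk'
    (fun σ => Multiplicative.ofAdd (IsLocalRing.residue 𝒪[L] (b σ))) hadd
  have hθ : Function.Injective θ := by
    rw [injective_iff_map_eq_one]
    intro σ hσ
    by_contra hne
    have h1 : (Valued.v ((σ π / π - 1) / π) : ℤᵐ⁰) < 1 :=
      (residue_eq_zero_iff_v_lt_one (b σ)).mp hσ
    have h2 := v_galois_uniformizer_sub hp hG htot hweak hπ hne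
    rw [show (σ π / π - 1) / π = (σ π - π) / π ^ 2 by field_simp, map_div₀, h2, map_pow, hπ,
      ← WithZero.exp_nsmul, ← WithZero.exp_sub, ← WithZero.exp_zero, WithZero.exp_lt_exp] at h1
    norm_num at h1
  refine ⟨fun σ τ => hθ ?_, fun σ => hθ ?_⟩
  · rw [map_mul, map_mul, mul_comm]
  · rw [map_pow, map_one]
    change Multiplicative.ofAdd (p • (θ σ).toAdd) = Multiplicative.ofAdd 0
    rw [nsmul_eq_mul, CharP.cast_eq_zero, zero_mul]

end Extension

end LocalExt

/-! ### Valuations of traces -/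

namespace LocalExt

section Extension

variable {K L : Type*} [Field K] [Valued K ℤᵐ⁰] [IsCompleteLocalField K]
  [Field L] [Valued L ℤᵐ⁰] [IsCompleteLocalField L] [Algebra K L]
  [(Valued.v : Valuation K ℤᵐ⁰).HasExtension (Valued.v : Valuation L ℤᵐ⁰)]
  [FiniteDimensional K L] [IsGalois K L]

open Classical in
/-- Euler's formula for the traces of `π ^ i / f'(π)`, where `f` is the minimal polynomial of a
primitive element `π`. -/
theorem sum_galois_pow_div_prod {K L : Type*} [Field K] [Field L] [Algebra K L]
    [FiniteDimensional K L] [IsGalois K L] {π : L}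
    (hπ : Function.Injective fun σ : Gal(L/K) => σ π) {i : ℕ} (hi : i < Module.finrank K L) :
    ∑ σ : Gal(L/K), σ (π ^ i / ∏ τ ∈ (Finset.univ : Finset Gal(L/K)).erase 1, (π - τ π)) =
      if i = Module.finrank K L - 1 then 1 else 0 := by
  have hcard : (Finset.univ : Finset Gal(L/K)).card = Module.finrank K L := by
    rw [Finset.card_univ, ← Nat.card_eq_fintype_card, IsGalois.card_aut_eq_finrank]
  -- Interpolating X^i at the N conjugates of π and reading off the coefficient of X^(N-1) gives the
  -- trace.
  have h := Lagrange.coeff_eq_sum (s := (Finset.univ : Finset Gal(L/K)))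
    (v := fun σ : Gal(L/K) => σ π) hπ.injOn (P := (Polynomial.X ^ i : Polynomial L)) (by
      rw [Polynomial.degree_X_pow, hcard]
      exact_mod_cast hi)
  rw [hcard, Polynomial.coeff_X_pow] at h
  rw [show (if i = Module.finrank K L - 1 then (1 : L) else 0) =
    if Module.finrank K L - 1 = i then 1 else 0 by simp [eq_comm], h]
  refine Finset.sum_congr rfl fun σ _ => ?_
  rw [map_div₀, map_pow, map_prod, Polynomial.eval_pow, Polynomial.eval_X]
  congr 1
  refine Finset.prod_bij (fun τ _ => σ * τ) ?_ ?_ ?_ ?_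
  · intro τ hτ
    simpa using hτ
  · intro τ _ τ' _ h
    exact mul_left_cancel h
  · intro τ hτ
    exact ⟨σ⁻¹ * τ, by simpa [inv_mul_eq_one, eq_comm] using hτ, by simp⟩
  · intro τ _
    simp

/-- The traces of the elements of `L`, in terms of valuations. -/
theorem exists_sum_galois_eq_algebraMap {p : ℕ} (hp : p.Prime) [CharP 𝓀[K] p]
    (hG : IsPGroup p Gal(L/K)) (htot : IsTotallyRamified K L) (hweak : IsWeaklyRamified K L)
    (x : L) : ∃ a : K, ∑ σ : Gal(L/K), σ x = algebraMap K L a ∧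
      (Valued.v (algebraMap K L a) : ℤᵐ⁰) ≤
        Valued.v x * WithZero.exp (1 - (Module.finrank K L : ℤ)) ∧
      ∀ q : ℤ, (Valued.v x : ℤᵐ⁰) = WithZero.exp (-(q * Module.finrank K L + 1)) →
        (Valued.v (algebraMap K L a) : ℤᵐ⁰) = WithZero.exp (-((q + 1) * Module.finrank K L)) := by
  classical
  obtain ⟨π, hπ⟩ := exists_uniformizer L
  have hN : 0 < Module.finrank K L := Module.finrank_pos
  have hsub : ∀ σ : Gal(L/K), σ ≠ 1 → (Valued.v (π - σ π) : ℤᵐ⁰) = WithZero.exp (-2) := by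
    intro σ hσ
    rw [Valuation.map_sub_swap]
    exact v_galois_uniformizer_sub hp hG htot hweak hπ hσ
  have hinj : Function.Injective fun σ : Gal(L/K) => σ π := by
    intro σ τ h
    by_contra hne
    have h1 := hsub (σ⁻¹ * τ) (fun h => hne (inv_mul_eq_one.mp h))
    have h2 : (σ⁻¹ * τ) π = π := by
      change σ.symm (τ π) = π
      rw [AlgEquiv.symm_apply_eq]
      exact h.symm
    rw [h2, sub_self, map_zero] at h1
    exact WithZero.exp_ne_zero h1.symm
  set D : L := ∏ τ ∈ (Finset.univ : Finset Gal(L/K)).erase 1, (π - τ π) with hD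
  have hcard : ((Finset.univ : Finset Gal(L/K)).erase 1).card = Module.finrank K L - 1 := by
    rw [Finset.card_erase_of_mem (Finset.mem_univ _), Finset.card_univ,
      ← Nat.card_eq_fintype_card, IsGalois.card_aut_eq_finrank]
  have hDv : (Valued.v D : ℤᵐ⁰) = WithZero.exp (2 - 2 * (Module.finrank K L : ℤ)) := by
    rw [hD, map_prod, Finset.prod_congr rfl fun τ hτ => hsub τ (Finset.ne_of_mem_erase hτ),
      Finset.prod_const, hcard, ← WithZero.exp_nsmul]
    congr 1
    rw [nsmul_eq_mul, Nat.cast_sub (by omega)]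
    push_cast
    ring
  have hD0 : D ≠ 0 := ne_zero_of_v_eq_exp hDv
  -- Expanding x * D rather than x makes Euler's formula pick out the last coefficient as the trace
  -- of x.
  obtain ⟨c, hc, hle, i₀, hi₀⟩ := exists_eq_sum_pow_uniformizer htot hπ (x * D)
  let l : Fin (Module.finrank K L) := ⟨Module.finrank K L - 1, by omega⟩
  have hl : ((l : ℕ) : ℤ) = Module.finrank K L - 1 := by
    simp only [l]
    omega
  have hx : x = ∑ i, c i • (π ^ (i : ℕ) / D) := by
    rw [← mul_div_cancel_right₀ x hD0, hc, Finset.sum_div]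
    simp [smul_div_assoc]
  have htr : ∑ σ : Gal(L/K), σ x = algebraMap K L (c l) := by
    calc ∑ σ : Gal(L/K), σ x = ∑ i, c i • ∑ σ : Gal(L/K), σ (π ^ (i : ℕ) / D) := by
          simp_rw [Finset.smul_sum]
          rw [Finset.sum_comm]
          refine Finset.sum_congr rfl fun σ _ => ?_
          conv_lhs => rw [hx]
          simp only [map_sum, map_smul]
      _ = ∑ i, if i = l then algebraMap K L (c l) else 0 := by
          refine Finset.sum_congr rfl fun i _ => ?_
          rw [sum_galois_pow_div_prod hinj i.2]
          by_cases h : i = l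
          · subst h
            simp [l, Algebra.smul_def]
          · have : (i : ℕ) ≠ Module.finrank K L - 1 := fun h' => h (Fin.ext h')
            simp [h, this]
      _ = _ := by simp
  have hlv : (Valued.v (π ^ (l : ℕ)) : ℤᵐ⁰) = WithZero.exp (1 - (Module.finrank K L : ℤ)) := by
    rw [v_pow_uniformizer hπ, hl]
    congr 1
    ring
  have hcv : (Valued.v (algebraMap K L (c l)) : ℤᵐ⁰) =
      Valued.v (c l • π ^ (l : ℕ)) * WithZero.exp ((Module.finrank K L : ℤ) - 1) := by
    rw [Algebra.smul_def, map_mul, hlv, mul_assoc, ← WithZero.exp_add]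
    simp
  refine ⟨c l, htr, ?_, fun q hq => ?_⟩
  · rw [hcv]
    refine (mul_le_mul_left (hle l) _).trans_eq ?_
    rw [map_mul, hDv, mul_assoc, ← WithZero.exp_add]
    congr 2
    ring
  · have h1 := hi₀
    rw [map_mul, hDv, hq, ← WithZero.exp_add] at h1
    have hc0 : c i₀ ≠ 0 := by
      intro h0
      rw [h0, zero_smul, map_zero] at h1
      exact WithZero.exp_ne_zero h1
    obtain ⟨a, ha, ha'⟩ := exists_v_smul_eq htot hc0 (v_pow_uniformizer hπ (i₀ : ℕ))
    have h2 := h1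
    rw [ha', WithZero.exp_inj] at h2
    -- Here v_L(x * D) = (q + 2)N - 1 ≡ N - 1 mod N, so the last term is the dominant one.
    have hil : i₀ = l := by
      refine fin_eq_of_modEq (Int.modEq_iff_dvd.mpr ⟨-(a + q + 1), ?_⟩)
      rw [hl]
      linear_combination -h2
    rw [hcv, ← hil, ← h1, ← WithZero.exp_add]
    congr 1
    ring

end Extension

end LocalExt

/-! ### Socle and invariants in group algebras -/

namespace MonoidAlgebra

variable {k G : Type*}

theorem coeff_eq_of_single_mul_eq [Semiring k] [Group G] {x : k[G]}
    (hx : ∀ g : G, single g 1 * x = x) (g : G) : x.coeff g = x.coeff 1 := by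
  conv_lhs => rw [← hx g]
  rw [coeff_single_mul_apply, one_mul, inv_mul_cancel]

theorem eq_smul_sum_single [Semiring k] [Group G] [Fintype G] {x : k[G]}
    (hx : ∀ g : G, single g 1 * x = x) : x = x.coeff 1 • ∑ g : G, single g 1 := by
  classical
  ext g
  rw [coeff_eq_of_single_mul_eq hx g]
  simp [coeff_sum, Finsupp.single_apply]

/-- The socle of the group algebra of a commutative `p`-group in characteristic `p` is spanned by
the sum of the group elements. -/
theorem exists_mul_eq_smul_sum_single [Field k] [Group G] [Fintype G]
    (hcomm : ∀ g h : G, g * h = h * g) {p : ℕ} (hp : p.Prime) [CharP k p] (hG : IsPGroup p G)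
    {a : k[G]} (ha : a ≠ 0) :
    ∃ (b : k[G]) (c : k), c ≠ 0 ∧ b * a = c • ∑ g : G, single g 1 := by
  classical
  have := Fact.mk hp
  have hchar : CharP k[G] p := charP_of_injective_algebraMap (algebraMap k k[G]).injective p
  -- Enlarge the set of group elements fixing a nonzero multiple of a, one element at a time.
  have key : ∀ S : Finset G, ∃ b : k[G], b * a ≠ 0 ∧ ∀ g ∈ S, single g 1 * (b * a) = b * a := by
    intro S
    induction S using Finset.induction_on with
    | empty => exact ⟨1, by simpa using ha, by simp⟩
    | insert g S _ ih =>
      obtain ⟨b, hb, hS⟩ := ih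
      -- g - 1 is nilpotent, and the last nonzero iterate of it on b * a is fixed by g.
      -- Commutativity keeps it fixed by S.
      have hnil : ∃ m : ℕ, (single g 1 - 1 : k[G]) ^ m * (b * a) = 0 := by
        obtain ⟨j, hj⟩ := hG g
        refine ⟨p ^ j, ?_⟩
        rw [sub_pow_char_pow_of_commute _ _ (Commute.one_right _), single_pow, hj, one_pow, one_pow,
          ← one_def, sub_self, zero_mul]
      have hpos : Nat.find hnil ≠ 0 := fun h => hb (by simpa [h] using Nat.find_spec hnil)
      obtain ⟨m, hm⟩ := Nat.exists_eq_succ_of_ne_zero hpos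
      have h1 : (single g 1 - 1 : k[G]) ^ m * (b * a) ≠ 0 :=
        Nat.find_min hnil (hm ▸ Nat.lt_succ_self m)
      have h2 : (single g 1 - 1 : k[G]) ^ (m + 1) * (b * a) = 0 := by
        have := Nat.find_spec hnil
        rwa [hm] at this
      refine ⟨(single g 1 - 1) ^ m * b, by rwa [mul_assoc], fun h hh => ?_⟩
      rcases Finset.mem_insert.mp hh with rfl | hh
      · rw [← sub_eq_zero]
        rw [← h2, pow_succ']
        simp only [sub_mul, one_mul, mul_assoc]
      · have hc : Commute (single h 1 : k[G]) ((single g 1 - 1) ^ m) :=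
          single_commute (hcomm h) (Commute.one_left) _
        rw [mul_assoc, ← mul_assoc, hc.eq, mul_assoc, hS h hh]
  obtain ⟨b, hb, hS⟩ := key Finset.univ
  have h := eq_smul_sum_single fun g => hS g (Finset.mem_univ g)
  refine ⟨b, (b * a).coeff 1, fun h0 => hb ?_, h⟩
  rw [h, h0, zero_smul]

end MonoidAlgebra

namespace MonoidAlgebra

/-- Coordinates of an invariant element in a basis are invariant in k[G], hence of the form c • ∑ g
= (∑ g) * (c at 1). The rank plays no role. -/
theorem exists_sum_single_smul_eq {k G M : Type*} [Semiring k] [Group G] [Fintype G]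
    [AddCommMonoid M] [Module k[G] M] [Module.Free k[G] M] {x : M}
    (hx : ∀ g : G, (single g 1 : k[G]) • x = x) :
    ∃ y : M, (∑ g : G, single g 1 : k[G]) • y = x := by
  let e := Module.Free.chooseBasis k[G] M
  refine ⟨e.repr.symm ((e.repr x).mapRange (fun z => single 1 (z.coeff 1)) (by simp)),
    e.repr.injective (Finsupp.ext fun i => ?_)⟩
  have h : e.repr x i = (e.repr x i).coeff 1 • ∑ g : G, single g 1 := by
    refine eq_smul_sum_single fun g => ?_
    conv_rhs => rw [← hx g]
    rw [map_smul, Finsupp.smul_apply, smul_eq_mul]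
  rw [map_smul, LinearEquiv.apply_symm_apply, Finsupp.smul_apply, Finsupp.mapRange_apply, h]
  simp [Finset.sum_mul, Finset.smul_sum, single_mul_single]

end MonoidAlgebra

/-! ### Galois module structure of the fractional ideals -/

namespace LocalExt

section GaloisAction

variable {K L : Type*} [Field K] [Valued K ℤᵐ⁰] [Field L] [Algebra K L] [FiniteDimensional K L]

theorem groupRing_smul_eq_sum (a : 𝒪[K][Gal(L/K)]) (x : L) :
    a • x = ∑ σ : Gal(L/K), (a.coeff σ : K) • σ x := by
  classical
  induction a using MonoidAlgebra.induction_linear with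
  | zero => simp
  | add f g hf hg =>
    rw [add_smul, hf, hg, ← Finset.sum_add_distrib]
    simp [add_smul]
  | single σ a =>
    rw [single_smul, Finset.sum_eq_single σ]
    · simp
    · intro τ _ h
      simp [h.symm]
    · simp

theorem sum_single_smul (x : L) :
    (∑ σ : Gal(L/K), MonoidAlgebra.single σ 1 : 𝒪[K][Gal(L/K)]) • x = ∑ σ : Gal(L/K), σ x := by
  rw [Finset.sum_smul]
  exact Finset.sum_congr rfl fun σ _ => by simp [single_smul]

end GaloisAction

section Extension

variable {K L : Type*} [Field K] [Valued K ℤᵐ⁰] [IsCompleteLocalField K]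
  [Field L] [Valued L ℤᵐ⁰] [IsCompleteLocalField L] [Algebra K L]
  [(Valued.v : Valuation K ℤᵐ⁰).HasExtension (Valued.v : Valuation L ℤᵐ⁰)]
  [FiniteDimensional K L] [IsGalois K L]

theorem mem_primePow {n : ℤ} {x : L} :
    x ∈ primePow K L n ↔ (Valued.v x : ℤᵐ⁰) ≤ WithZero.exp (-n) := Iff.rfl

theorem v_algebraMap_le_of_lt_one (htot : IsTotallyRamified K L) {c : K}
    (hc : (Valued.v c : ℤᵐ⁰) < 1) :
    (Valued.v (algebraMap K L c) : ℤᵐ⁰) ≤ WithZero.exp (-(Module.finrank K L : ℤ)) := by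
  rw [v_algebraMap htot]
  refine (pow_le_pow_left' (lt_one_iff_le_exp.mp hc) _).trans_eq ?_
  rw [← WithZero.exp_nsmul]
  simp

/-- A group ring element that is nonzero modulo the maximal ideal of `𝒪[K]` does not map an
element of valuation `q * [L : K] + 1` into `𝔓_L ^ ((q + 1) * [L : K] + 1)`. -/
theorem smul_notMem_primePow {p : ℕ} (hp : p.Prime) [CharP 𝓀[K] p]
    (hG : IsPGroup p Gal(L/K)) (htot : IsTotallyRamified K L) (hweak : IsWeaklyRamified K L)
    {δ : L} {q : ℤ} (hδ : (Valued.v δ : ℤᵐ⁰) = WithZero.exp (-(q * Module.finrank K L + 1)))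
    {a : 𝒪[K][Gal(L/K)]} {σ₀ : Gal(L/K)} (ha : (Valued.v (a.coeff σ₀ : K) : ℤᵐ⁰) = 1) :
    a • δ ∉ primePow K L ((q + 1) * Module.finrank K L + 1) := by
  intro hmem
  let r := MonoidAlgebra.mapRingHom Gal(L/K) (IsLocalRing.residue 𝒪[K])
  have ha0 : r a ≠ 0 := by
    intro h
    have h1 : (r a).coeff σ₀ = 0 := by rw [h]; rfl
    rw [MonoidAlgebra.coeff_mapRingHom, residue_eq_zero_iff_v_lt_one, ha] at h1
    exact lt_irrefl _ h1
  obtain ⟨b', c', hc', hbc⟩ := MonoidAlgebra.exists_mul_eq_smul_sum_single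
    (isElementaryAbelian_gal hp hG htot hweak).1 hp hG ha0
  have hsurj := IsLocalRing.residue_surjective (R := 𝒪[K])
  obtain ⟨c, rfl⟩ := hsurj c'
  choose l hl using fun σ => hsurj (b'.coeff σ)
  let b : 𝒪[K][Gal(L/K)] := ∑ σ : Gal(L/K), MonoidAlgebra.single σ (l σ)
  have hb : r b = b' := by
    classical
    ext σ
    simp [r, b, MonoidAlgebra.coeff_sum, hl]
  let S : 𝒪[K][Gal(L/K)] := ∑ σ : Gal(L/K), MonoidAlgebra.single σ 1
  -- The error of lifting the socle relation has coefficients in the maximal ideal of 𝒪[K]. Acting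
  -- on δ, it gains N in valuation and lands in the target ideal.
  let d := b * a - MonoidAlgebra.single 1 c * S
  have hd : ∀ σ, (Valued.v (d.coeff σ : K) : ℤᵐ⁰) < 1 := by
    intro σ
    have h : r d = 0 := by
      simp only [d, map_sub, map_mul, hb, hbc, S, map_sum]
      simp [r, Finset.mul_sum, Finset.smul_sum, MonoidAlgebra.single_mul_single]
    rw [← residue_eq_zero_iff_v_lt_one, ← MonoidAlgebra.coeff_mapRingHom]
    change (r d).coeff σ = 0
    rw [h]
    rfl
  have hdδ : d • δ ∈ primePow K L ((q + 1) * Module.finrank K L + 1) := by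
    rw [mem_primePow, groupRing_smul_eq_sum]
    refine Valuation.map_sum_le _ fun σ _ => ?_
    rw [Algebra.smul_def, map_mul, v_galois, hδ]
    refine (mul_le_mul_left (v_algebraMap_le_of_lt_one htot (hd σ)) _).trans_eq ?_
    rw [← WithZero.exp_add]
    congr 1
    ring
  have hcS : (b * a - d) • δ ∈ primePow K L ((q + 1) * Module.finrank K L + 1) := by
    rw [sub_smul, mul_smul]
    exact sub_mem (Submodule.smul_mem _ b hmem) hdδ
  rw [show b * a - d = MonoidAlgebra.single 1 c * S by simp [d],
    mul_smul, sum_single_smul, single_smul, mem_primePow] at hcS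
  obtain ⟨t, ht, -, htv⟩ := exists_sum_galois_eq_algebraMap hp hG htot hweak δ
  have hc1 : (Valued.v (c : K) : ℤᵐ⁰) = 1 := by
    refine le_antisymm c.2 (not_lt.mp fun h => hc' ?_)
    rwa [residue_eq_zero_iff_v_lt_one]
  rw [AlgEquiv.one_apply, Algebra.smul_def, map_mul, v_algebraMap htot, hc1, one_pow, one_mul,
    ht, htv q hδ, WithZero.exp_le_exp] at hcS
  omega

/-- Dividing by a coefficient of largest value makes all coefficients integral and one of them 1,
which reduces to `smul_notMem_primePow`. -/
theorem lt_v_sum_smul_galois {p : ℕ} (hp : p.Prime) [CharP 𝓀[K] p]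
    (hG : IsPGroup p Gal(L/K)) (htot : IsTotallyRamified K L) (hweak : IsWeaklyRamified K L)
    {δ : L} {q : ℤ} (hδ : (Valued.v δ : ℤᵐ⁰) = WithZero.exp (-(q * Module.finrank K L + 1)))
    {c : Gal(L/K) → K} (hc : c ≠ 0) (σ : Gal(L/K)) :
    (Valued.v (algebraMap K L (c σ)) : ℤᵐ⁰) *
      WithZero.exp (-((q + 1) * Module.finrank K L + 1)) < Valued.v (∑ τ, c τ • τ δ) := by
  classical
  obtain ⟨σ₀, -, hσ₀⟩ := Finset.exists_max_image Finset.univ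
    (fun τ => (Valued.v (c τ) : ℤᵐ⁰)) ⟨1, Finset.mem_univ _⟩
  have h0 : c σ₀ ≠ 0 := by
    refine fun h0 => hc (funext fun τ => ?_)
    simpa [h0] using hσ₀ τ (Finset.mem_univ τ)
  have h0' : (Valued.v (c σ₀) : ℤᵐ⁰) ≠ 0 := (Valuation.ne_zero_iff _).mpr h0
  have h0L : (Valued.v (algebraMap K L (c σ₀)) : ℤᵐ⁰) ≠ 0 :=
    (Valuation.ne_zero_iff _).mpr (by simpa using h0)
  have hle : ∀ τ, (Valued.v (c τ / c σ₀) : ℤᵐ⁰) ≤ 1 := by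
    intro τ
    rw [map_div₀]
    exact (div_le_one₀ (zero_lt_iff.mpr h0')).mpr (hσ₀ τ (Finset.mem_univ τ))
  let a : 𝒪[K][Gal(L/K)] := ∑ τ : Gal(L/K), MonoidAlgebra.single τ ⟨c τ / c σ₀, hle τ⟩
  have ha : ∀ τ, (a.coeff τ : K) = c τ / c σ₀ := by
    intro τ
    simp [a, MonoidAlgebra.coeff_sum, Finsupp.single_apply]
  have h1 := smul_notMem_primePow hp hG htot hweak hδ (a := a) (σ₀ := σ₀) (by simp [ha, h0])
  have h2 : ∑ τ, c τ • τ δ = c σ₀ • a • δ := by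
    rw [groupRing_smul_eq_sum, Finset.smul_sum]
    refine Finset.sum_congr rfl fun τ _ => ?_
    rw [ha, smul_smul, mul_div_cancel₀ _ h0]
  rw [mem_primePow, not_le] at h1
  rw [h2, Algebra.smul_def, map_mul]
  refine lt_of_le_of_lt (mul_le_mul_left ?_ _) ((mul_lt_mul_iff_right₀ (zero_lt_iff.mpr h0L)).mpr h1)
  rw [v_algebraMap htot, v_algebraMap htot]
  exact pow_le_pow_left' (hσ₀ σ (Finset.mem_univ σ)) _

/-- The strict bound `lt_v_sum_smul_galois` makes the conjugates of δ a normal basis, and also makes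
the coordinates of elements of the ideal integral. -/
theorem isFreeGenerator_of_v_eq {p : ℕ} (hp : p.Prime) [CharP 𝓀[K] p]
    (hG : IsPGroup p Gal(L/K)) (htot : IsTotallyRamified K L) (hweak : IsWeaklyRamified K L)
    {δ : L} {q : ℤ} (hδ : (Valued.v δ : ℤᵐ⁰) = WithZero.exp (-(q * Module.finrank K L + 1))) :
    IsFreeGenerator (primePow K L (q * Module.finrank K L + 1)) δ := by
  classical
  have hli : LinearIndependent K fun τ : Gal(L/K) => τ δ := by
    rw [Fintype.linearIndependent_iff]
    intro c hc
    by_contra! hne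
    obtain ⟨σ, hσ⟩ := hne
    have h := lt_v_sum_smul_galois hp hG htot hweak hδ (c := c) (fun h0 => hσ (by simp [h0])) σ
    rw [hc, map_zero] at h
    exact not_lt_zero h
  have hcard : Fintype.card Gal(L/K) = Module.finrank K L := by
    rw [← Nat.card_eq_fintype_card, IsGalois.card_aut_eq_finrank]
  refine ⟨fun a a' haa' => ?_, Set.Subset.antisymm ?_ fun x hx => ?_⟩
  · have h0 : (a - a') • δ = 0 := by rw [sub_smul]; exact sub_eq_zero.mpr haa'
    rw [groupRing_smul_eq_sum] at h0
    have h1 := Fintype.linearIndependent_iff.mp hli _ h0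
    rw [← sub_eq_zero]
    ext σ
    simpa using h1 σ
  · rintro _ ⟨a, rfl⟩
    exact Submodule.smul_mem _ a hδ.le
  · have hspan : x ∈ Submodule.span K (Set.range fun τ : Gal(L/K) => τ δ) := by
      rw [hli.span_eq_top_of_card_eq_finrank' hcard]
      trivial
    obtain ⟨c, rfl⟩ := (Submodule.mem_span_range_iff_exists_fun K).mp hspan
    have hc : ∀ σ, (Valued.v (c σ) : ℤᵐ⁰) ≤ 1 := by
      intro σ
      rcases eq_or_ne c 0 with rfl | h0
      · simp
      have h1 := (lt_v_sum_smul_galois hp hG htot hweak hδ h0 σ).trans_le hx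
      by_contra! hcon
      have hcσ : c σ ≠ 0 := by
        rintro h
        simp [h] at hcon
      obtain ⟨m, hm⟩ := exists_v_eq_exp hcσ
      rw [hm, ← WithZero.exp_zero, WithZero.exp_lt_exp] at hcon
      rw [v_algebraMap htot, hm, ← WithZero.exp_nsmul, ← WithZero.exp_add, WithZero.exp_lt_exp,
        nsmul_eq_mul] at h1
      -- A non-integral coefficient has m ≥ 1, while `h1` says N * m < N.
      have h2 : (Module.finrank K L : ℤ) * 1 ≤ Module.finrank K L * m :=
        mul_le_mul_of_nonneg_left hcon (by positivity)
      linarith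
    refine ⟨∑ τ : Gal(L/K), MonoidAlgebra.single τ ⟨c τ, hc τ⟩, ?_⟩
    simp only [Finset.sum_smul, single_smul]

/-- If δ lay in the next smaller ideal, so would all its multiples, missing the elements of
valuation exactly n. -/
theorem v_eq_of_isFreeGenerator {n : ℤ} {δ : L} (h : IsFreeGenerator (primePow K L n) δ) :
    (Valued.v δ : ℤᵐ⁰) = WithZero.exp (-n) := by
  have hδ : δ ∈ (primePow K L n : Set L) := by
    rw [← h.2]
    exact ⟨1, one_smul _ δ⟩
  refine le_antisymm hδ (not_lt.mp fun hlt => ?_)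
  have hδ' : δ ∈ primePow K L (n + 1) := by
    rw [mem_primePow, neg_add']
    exact lt_exp_iff_le_exp.mp hlt
  obtain ⟨x, hx⟩ := IsCompleteLocalField.surjective_v (K := L) (WithZero.exp (-n))
  have hxn : x ∈ (primePow K L n : Set L) := hx.le
  rw [← h.2] at hxn
  obtain ⟨a, rfl⟩ := hxn
  have := (primePow K L (n + 1)).smul_mem a hδ'
  rw [mem_primePow, hx, WithZero.exp_le_exp] at this
  omega

theorem nonempty_linearEquiv_of_isFreeGenerator {n : ℤ} {δ : L}
    (h : IsFreeGenerator (primePow K L n) δ) :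
    Nonempty (𝒪[K][Gal(L/K)] ≃ₗ[𝒪[K][Gal(L/K)]] primePow K L n) := by
  have hδ : δ ∈ primePow K L n := (v_eq_of_isFreeGenerator h).le
  refine ⟨LinearEquiv.ofBijective
    (LinearMap.toSpanSingleton 𝒪[K][Gal(L/K)] (primePow K L n) ⟨δ, hδ⟩) ⟨?_, ?_⟩⟩
  · intro a a' haa'
    exact h.1 (congrArg Subtype.val haa')
  · rintro ⟨x, hx⟩
    have hx' : x ∈ (primePow K L n : Set L) := hx
    rw [← h.2] at hx'
    obtain ⟨a, rfl⟩ := hx'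
    exact ⟨a, rfl⟩

/-- The least power of ϖ in 𝔓_L^n, of valuation (q + 1)N, is invariant, hence the trace of some Y in
𝔓_L^n. So (q + 1)N ≥ n + N - 1, that is n ≤ qN + 1, while n ≥ qN + 1 by choice of q. -/
theorem modEq_one_of_free {p : ℕ} (hp : p.Prime) [CharP 𝓀[K] p]
    (hG : IsPGroup p Gal(L/K)) (htot : IsTotallyRamified K L) (hweak : IsWeaklyRamified K L)
    {n : ℤ} (h : Module.Free 𝒪[K][Gal(L/K)] (primePow K L n)) :
    n ≡ 1 [ZMOD Module.finrank K L] := by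
  have hN : 0 < (Module.finrank K L : ℤ) := by exact_mod_cast Module.finrank_pos
  have hdiv := Int.mul_ediv_add_emod (n - 1) (Module.finrank K L)
  have hmod := Int.emod_nonneg (n - 1) hN.ne'
  have hlt := Int.emod_lt_of_pos (n - 1) hN
  set q := (n - 1) / (Module.finrank K L : ℤ)
  set s := (n - 1) % (Module.finrank K L : ℤ)
  obtain ⟨ϖ, hϖ⟩ := exists_uniformizer K
  have hx : (Valued.v (algebraMap K L (ϖ ^ (q + 1))) : ℤᵐ⁰) =
      WithZero.exp (-((q + 1) * Module.finrank K L)) := by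
    rw [v_algebraMap htot, map_zpow₀, hϖ, ← WithZero.exp_zsmul, ← WithZero.exp_nsmul]
    congr 1
    simp only [nsmul_eq_mul, smul_eq_mul]
    ring
  let X : primePow K L n := ⟨algebraMap K L (ϖ ^ (q + 1)), by
    rw [mem_primePow, hx, WithZero.exp_le_exp]
    linarith⟩
  obtain ⟨Y, hY⟩ := MonoidAlgebra.exists_sum_single_smul_eq (k := 𝒪[K]) (G := Gal(L/K)) (x := X)
    (fun σ => Subtype.ext (by
      change (MonoidAlgebra.single σ 1 : 𝒪[K][Gal(L/K)]) • algebraMap K L (ϖ ^ (q + 1)) =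
        algebraMap K L (ϖ ^ (q + 1))
      rw [single_smul, AlgEquiv.commutes]
      simp))
  have hY' : ∑ σ : Gal(L/K), σ (Y : L) = algebraMap K L (ϖ ^ (q + 1)) := by
    rw [← sum_single_smul]
    exact congrArg Subtype.val hY
  obtain ⟨t, ht, htv, -⟩ := exists_sum_galois_eq_algebraMap hp hG htot hweak (Y : L)
  rw [← ht, hY', hx] at htv
  have h1 := htv.trans (mul_le_mul_left (mem_primePow.mp Y.2) _)
  rw [← WithZero.exp_add, WithZero.exp_le_exp] at h1
  refine (Int.modEq_iff_dvd.mpr ⟨q, ?_⟩).symm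
  linarith

end Extension

end LocalExt

theorem theorem5p2 (p : ℕ) (hp : p.Prime)
    (K L : Type*) [Field K] [Valued K ℤᵐ⁰] [IsCompleteLocalField K]
    [CharP 𝓀[K] p] [PerfectField 𝓀[K]]
    [Field L] [Valued L ℤᵐ⁰] [IsCompleteLocalField L] [Algebra K L]
    [(Valued.v : Valuation K ℤᵐ⁰).HasExtension (Valued.v : Valuation L ℤᵐ⁰)]
    [FiniteDimensional K L] [IsGalois K L]
    (hG : IsPGroup p Gal(L/K))
    (htot : LocalExt.IsTotallyRamified K L) (hweak : LocalExt.IsWeaklyRamified K L) :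
    IsElementaryAbelian p Gal(L/K) ∧
    ∀ n : ℤ,
      (Module.Free 𝒪[K][Gal(L/K)] (LocalExt.primePow K L n) ↔ n ≡ 1 [ZMOD Nat.card Gal(L/K)]) ∧
      (Module.Free 𝒪[K][Gal(L/K)] (LocalExt.primePow K L n) →
        Nonempty (𝒪[K][Gal(L/K)] ≃ₗ[𝒪[K][Gal(L/K)]] LocalExt.primePow K L n)) ∧
      (n ≡ 1 [ZMOD Nat.card Gal(L/K)] → ∀ δ : L,
        LocalExt.IsFreeGenerator (LocalExt.primePow K L n) δ ↔
          Valued.v δ = WithZero.exp (-n)) := by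
  refine ⟨LocalExt.isElementaryAbelian_gal hp hG htot hweak, fun n => ?_⟩
  rw [IsGalois.card_aut_eq_finrank]
  have hgen : n ≡ 1 [ZMOD Module.finrank K L] → ∀ δ : L,
      LocalExt.IsFreeGenerator (LocalExt.primePow K L n) δ ↔
        Valued.v δ = WithZero.exp (-n) := by
    intro hn δ
    obtain ⟨q, hq⟩ := Int.modEq_iff_dvd.mp hn.symm
    obtain rfl : n = q * Module.finrank K L + 1 := by linarith
    exact ⟨LocalExt.v_eq_of_isFreeGenerator,
      LocalExt.isFreeGenerator_of_v_eq hp hG htot hweak⟩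
  have hequiv : n ≡ 1 [ZMOD Module.finrank K L] →
      Nonempty (𝒪[K][Gal(L/K)] ≃ₗ[𝒪[K][Gal(L/K)]] LocalExt.primePow K L n) := by
    intro hn
    obtain ⟨δ, hδ⟩ := IsCompleteLocalField.surjective_v (K := L) (WithZero.exp (-n))
    exact LocalExt.nonempty_linearEquiv_of_isFreeGenerator ((hgen hn δ).mpr hδ)
  have hfree := LocalExt.modEq_one_of_free hp hG htot hweak (n := n)
  exact ⟨⟨hfree, fun hn => (hequiv hn).elim fun e => Module.Free.of_equiv e⟩,
    fun h => hequiv (hfree h), hgen⟩
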